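/- Let $N\ge 1$ be an integer and let $0<s<1$, $N>2s$ and $p>\frac{N}{N-2s}$. Write $$(-\Delta)^s u(x)=C_{N,s}\,\lim_{\varepsilon\to0^+}\int_{\{|x-y|\ge\varepsilon\}}\frac{u(x)-u(y)}{|x-y|^{N+2s}}\,dy,\qquad C_{N,s}=\frac{s\,4^s\,\Gamma(\frac N2+s)}{\pi^{N/2}\,\Gamma(1-s)},$$ let $B_{R_0}$ be the open ball of radius $R_0$ centred at $0$, and call $u:\mathbb{R}^N\to\mathbb{R}$ a classical supersolution of $$(-\Delta)^s u+|\nabla u|^q=\lambda u^p\quad\text{in }\mathbb{R}^N\setminus B_{R_0}\qquad(\ast)$$ if $u$ is measurable with $\int_{\mathbb{R}^N}\frac{|u(x)|}{1+|x|^{N+2s}}\,dx<\infty$, $u$ is of class $C^2$ in a neighbourhood of $\mathbb{R}^N\setminus B_{R_0}$, and at every $x\in\mathbb{R}^N\setminus B_{R_0}$ the limit $(-\Delta)^s u(x)$ exists, with absolutely convergent truncated integrals, and $(-\Delta)^s u(x)+|\nabla u(x)|^q\ge\lambda u(x)^p$. Then there is a positive bounded function $u:\mathbb{R}^N\to\mathbb{R}$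 that is a classical supersolution of $(\ast)$ for all $q\ge0$, all $\lambda\le1$ and all $R_0>0$. More precisely, the interval $\left(\frac1{p-1},\frac{N-2s}{2s}\right)$ is non-empty, and for every $\beta$ in it there is a constant $C>0$ such that the positive bounded function $v_\beta(x)=C(1+|x|)^{-2s\beta}$ is a classical supersolution of $(\ast)$ for all $q\ge0$, all $\lambda\le1$ and all $R_0>0$. -/

import Mathlib

open scoped Topology

noncomputable section

/-- The normalization constant `C_{N,s} = s 4^s Γ(N/2 + s) / (π^(N/2) Γ(1 - s))` for which the
fractional Laplacian has Fourier symbol `|ξ|^(2s)`. -/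
def fracLapConst (N : ℕ) (s : ℝ) : ℝ :=
  s * (4 : ℝ) ^ s * Real.Gamma ((N : ℝ) / 2 + s) /
    (Real.pi ^ ((N : ℝ) / 2) * Real.Gamma (1 - s))

/-- `HasFracLap s u x L` says that `(-Δ)^s u (x)` exists and equals `L`, where
`(-Δ)^s u (x) = C_{N,s} P.V. ∫ (u x - u y) / |x - y|^(N + 2s) dy`:
the truncated integrals over the complements of the balls `B_ε(x)` converge absolutely, and
they tend to `L` (after normalization) as `ε → 0+`. -/
def HasFracLap {N : ℕ} (s : ℝ) (u : EuclideanSpace ℝ (Fin N) → ℝ)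
    (x : EuclideanSpace ℝ (Fin N)) (L : ℝ) : Prop :=
  (∀ ε : ℝ, 0 < ε → MeasureTheory.IntegrableOn
      (fun y => (u x - u y) / ‖x - y‖ ^ ((N : ℝ) + 2 * s)) (Metric.ball x ε)ᶜ) ∧
  Filter.Tendsto
    (fun ε : ℝ => fracLapConst N s *
      ∫ y in (Metric.ball x ε)ᶜ, (u x - u y) / ‖x - y‖ ^ ((N : ℝ) + 2 * s))
    (𝓝[>] 0) (𝓝 L)

/-- The weighted space `𝓛_{2s}`: measurable functions with
`∫ |u x| / (1 + |x|^(N + 2s)) dx < ∞`. -/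
def MemL2s {N : ℕ} (s : ℝ) (u : EuclideanSpace ℝ (Fin N) → ℝ) : Prop :=
  MeasureTheory.Integrable (fun x => u x / (1 + ‖x‖ ^ ((N : ℝ) + 2 * s)))

/-- Classical supersolution of `(-Δ)^s u + |∇u|^q = lam * f u` in `ℝ^N ∖ B_{R₀}`, where `B_{R₀}`
is the open ball with centre `0`: `u` belongs to `𝓛_{2s}`, is of class `C²` in a neighbourhood of
every point of the closed set `ℝ^N ∖ B_{R₀}`, and the inequality
`(-Δ)^s u + |∇u|^q ≥ lam * f u` holds at every point of this set (in particular `(-Δ)^s u`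
exists there). -/
structure IsClassicalSupersolution {N : ℕ} (s q lam : ℝ) (f : ℝ → ℝ) (R₀ : ℝ)
    (u : EuclideanSpace ℝ (Fin N) → ℝ) : Prop where
  memL2s : MemL2s s u
  contDiffAt : ∀ x ∈ (Metric.ball (0 : EuclideanSpace ℝ (Fin N)) R₀)ᶜ, ContDiffAt ℝ 2 u x
  ineq : ∀ x ∈ (Metric.ball (0 : EuclideanSpace ℝ (Fin N)) R₀)ᶜ,
    ∃ L : ℝ, HasFracLap s u x L ∧ lam * f (u x) ≤ L + ‖gradient u x‖ ^ q

end

section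

open MeasureTheory Metric Set Filter

/-! Put w(x) = (1+|x|)^(-a) with 0 < a < N - 2s. Off the origin, (-Δ)^s w ≥ c (1+|x|)^(-a-2s)
(`exists_hasFracLap_ge`). For a = 2sβ, the condition β > 1/(p-1) gives a + 2s < ap, so C w with
C^(p-1) = c satisfies (-Δ)^s (C w) ≥ (C w)^p. The gradient term is nonnegative and λ ≤ 1 only helps.

The bound comes from pairing each z with |z| > |x| with its inverse z* in the sphere of radius |x|.
Jacobian and kernel combine into the weight τ^(N-2s), τ = |x|/|z| (`kelvin_pair_eq`), so the gain
w(x) - w(z) competes with the loss τ^(N-2s) (w(z*) - w(x)). Convexity of t^(-a) makes every pair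
nonnegative (`kelvin_gain_nonneg`); the pairs with z in a ball of radius 1+|x|, at distance a large
multiple of 1+|x| from the origin, already supply c (`kelvin_gain_lower_bound`). The principal value
itself exists by a second-order Taylor bound (`exists_hasFracLap`). -/

/-! ### Existence of the principal value -/

lemma integrableOn_diffQuot_compl_ball {N : ℕ} {s : ℝ} (hs : 0 < s)
    {u : EuclideanSpace ℝ (Fin N) → ℝ} (hu : Measurable u) {M : ℝ} (hM : ∀ y, |u y| ≤ M)
    (x : EuclideanSpace ℝ (Fin N)) {ε : ℝ} (hε : 0 < ε) :
    IntegrableOn (fun y => (u x - u y) / ‖x - y‖ ^ ((N : ℝ) + 2 * s)) (ball x ε)ᶜ := by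
  have hfr : (Module.finrank ℝ (EuclideanSpace ℝ (Fin N)) : ℝ) < (N : ℝ) + 2 * s := by
    simp; linarith
  have hint := ((integrable_one_add_norm (μ := (volume : Measure (EuclideanSpace ℝ (Fin N))))
    hfr).comp_sub_left x).const_mul (2 * M * (1 + 1 / ε) ^ ((N : ℝ) + 2 * s))
  refine Integrable.mono' hint.integrableOn ?_ ?_
  · have : Measurable fun y => (u x - u y) / ‖x - y‖ ^ ((N : ℝ) + 2 * s) := by fun_prop
    exact this.aestronglyMeasurable
  · refine (ae_restrict_iff' measurableSet_ball.compl).2 (Eventually.of_forall fun y hy => ?_)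
    have hd : ε ≤ ‖x - y‖ := by
      simpa [dist_eq_norm, norm_sub_rev] using hy
    have hd0 : 0 < ‖x - y‖ := hε.trans_le hd
    have hm : (0 : ℝ) ≤ (N : ℝ) + 2 * s := by positivity
    rw [norm_div, Real.norm_eq_abs, Real.norm_eq_abs, abs_of_nonneg (Real.rpow_nonneg hd0.le _)]
    have h1 : |u x - u y| ≤ 2 * M := by
      have := abs_sub (u x) (u y)
      linarith [hM x, hM y]
    have hM0 : 0 ≤ 2 * M := (abs_nonneg _).trans h1
    -- Since |x-y| ≥ ε, 1 + |x-y| ≤ (1 + 1/ε)|x-y|; this explains the constant in `hint`.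
    have h2 : (1 + ‖x - y‖) ^ ((N : ℝ) + 2 * s)
        ≤ (1 + 1 / ε) ^ ((N : ℝ) + 2 * s) * ‖x - y‖ ^ ((N : ℝ) + 2 * s) := by
      rw [← Real.mul_rpow (by positivity) hd0.le]
      apply Real.rpow_le_rpow (by positivity) _ hm
      have : 1 ≤ 1 / ε * ‖x - y‖ := by
        rw [one_div, ← div_eq_inv_mul, le_div_iff₀ hε]; linarith
      linarith
    rw [Real.rpow_neg (by positivity), mul_assoc, ← div_eq_mul_inv, div_eq_mul_inv]
    refine mul_le_mul h1 ?_ (by positivity) hM0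
    rw [le_div_iff₀ (by positivity), ← div_eq_inv_mul, div_le_iff₀ (by positivity)]
    exact h2

/-- The derivative is Lipschitz near x, so on the closed ball of radius |y-x| it differs from its
value at x by at most K|y-x|; the mean value inequality supplies the second factor. -/
lemma ContDiffAt.exists_taylor_bound {E : Type*} [NormedAddCommGroup E] [NormedSpace ℝ E]
    {u : E → ℝ} {x : E} (hu : ContDiffAt ℝ 2 u x) :
    ∃ K δ : ℝ, 0 ≤ K ∧ 0 < δ ∧ ∀ y ∈ ball x δ, |u y - u x - fderiv ℝ u x (y - x)| ≤ K * ‖y - x‖ ^ 2 := by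
  obtain ⟨K, t, ht, hK⟩ := (hu.fderiv_right (m := 1) (by norm_num)).exists_lipschitzOnWith
  have hd : ∀ᶠ y in 𝓝 x, DifferentiableAt ℝ u y :=
    (hu.eventually (by simp)).mono fun y hy => hy.differentiableAt (by simp)
  obtain ⟨δ, hδ, h⟩ := Metric.mem_nhds_iff.1 (inter_mem ht hd)
  refine ⟨K, δ, K.2, hδ, fun y hy => ?_⟩
  have hsub : closedBall x ‖y - x‖ ⊆ ball x δ :=
    closedBall_subset_ball (by simpa [dist_eq_norm] using hy)
  have := (convex_closedBall x ‖y - x‖).norm_image_sub_le_of_norm_fderiv_le' (𝕜 := ℝ) (f := u)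
    (φ := fderiv ℝ u x) (C := K * ‖y - x‖) (fun z hz => (h (hsub hz)).2) (fun z hz => ?_)
    (mem_closedBall_self (norm_nonneg _)) (y := y) (by simp [dist_eq_norm])
  · rw [Real.norm_eq_abs] at this
    linarith
  · have h1 := hK.dist_le_mul z (h (hsub hz)).1 x (mem_of_mem_nhds ht)
    rw [dist_eq_norm] at h1
    exact h1.trans (mul_le_mul_of_nonneg_left (by simpa using hz) K.2)

/-- The reflection y ↦ 2x - y preserves both the measure and the complement of the ball. -/
lemma setIntegral_eq_zero_of_odd_about {E : Type*} [NormedAddCommGroup E] [MeasurableSpace E]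
    [BorelSpace E] (μ : Measure E) [μ.IsAddLeftInvariant] [μ.IsNegInvariant]
    {g : E → ℝ} (x : E) (hg : ∀ y, g (x + x - y) = -g y) (ε : ℝ) :
    ∫ y in (ball x ε)ᶜ, g y ∂μ = 0 := by
  rw [← integral_indicator measurableSet_ball.compl]
  have h := integral_sub_left_eq_self ((ball x ε)ᶜ.indicator g) μ (x + x)
  have h2 : ∀ y, (ball x ε)ᶜ.indicator g (x + x - y) = -(ball x ε)ᶜ.indicator g y := fun y => by
    have : x + x - y ∈ (ball x ε)ᶜ ↔ y ∈ (ball x ε)ᶜ := by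
      simp only [mem_compl_iff, mem_ball, dist_eq_norm]
      rw [show x + x - y - x = x - y by abel, norm_sub_rev]
    by_cases hy : y ∈ (ball x ε)ᶜ
    · rw [indicator_of_mem (this.2 hy), indicator_of_mem hy, hg]
    · rw [indicator_of_notMem (mt this.1 hy), indicator_of_notMem hy, neg_zero]
  simp_rw [h2, integral_neg] at h
  linarith

/-- The fractional Laplacian of a bounded function exists at every point where it is `C²`. -/
theorem exists_hasFracLap {N : ℕ} {s : ℝ} (hs0 : 0 < s) (hs1 : s < 1)
    {u : EuclideanSpace ℝ (Fin N) → ℝ} (hu : Measurable u) {M : ℝ} (hM : ∀ y, |u y| ≤ M)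
    {x : EuclideanSpace ℝ (Fin N)} (hN : 1 ≤ N) (hx : ContDiffAt ℝ 2 u x) :
    ∃ L, HasFracLap s u x L := by
  obtain ⟨K, δ, hK0, hδ, hK⟩ := hx.exists_taylor_bound
  have hcompl := fun ε (hε : (0 : ℝ) < ε) => integrableOn_diffQuot_compl_ball hs0 hu hM x hε
  set f : EuclideanSpace ℝ (Fin N) → ℝ :=
    fun y => (u x - u y) / ‖x - y‖ ^ ((N : ℝ) + 2 * s) with hf
  -- The linear Taylor term is odd about x, so it drops out of every truncated integral; cut off at
  -- δ, it leaves `f` unchanged far away.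
  set g : EuclideanSpace ℝ (Fin N) → ℝ := (ball x δ).indicator
    fun y => fderiv ℝ u x (x - y) / ‖x - y‖ ^ ((N : ℝ) + 2 * s) with hg
  have hfm : Measurable f := by fun_prop
  have hgm : Measurable g := by
    apply Measurable.indicator _ measurableSet_ball
    fun_prop
  have hodd : ∀ y, g (x + x - y) = -g y := fun y => by
    have hn : ‖x - (x + x - y)‖ = ‖x - y‖ := by
      rw [show x - (x + x - y) = -(x - y) by abel, norm_neg]
    have : x + x - y ∈ ball x δ ↔ y ∈ ball x δ := by
      simp only [mem_ball, dist_eq_norm]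
      rw [show x + x - y - x = x - y by abel, norm_sub_rev]
    by_cases hy : y ∈ ball x δ
    · simp only [hg]
      rw [indicator_of_mem (this.2 hy), indicator_of_mem hy, hn,
        show x - (x + x - y) = -(x - y) by abel, map_neg, neg_div]
    · simp only [hg]
      rw [indicator_of_notMem (mt this.1 hy), indicator_of_notMem hy, neg_zero]
  have hball : IntegrableOn (f - g) (ball x δ) := by
    have h0 : IntegrableOn (fun h => (f - g) (x + h)) (ball 0 δ) := by
      -- The Taylor remainder gives |h|^(2-N-2s), integrable near 0 because s < 1.
      refine integrableOn_ball_of_norm_le_rpow (C := K) (α := (N : ℝ) + 2 * s - 2)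
        (by simpa using hN) (by simp; linarith) ?_
        ((hfm.sub hgm).comp (measurable_const_add x)).aestronglyMeasurable
      refine (ae_restrict_iff' measurableSet_ball).2 (Eventually.of_forall fun h hh => ?_)
      have hxh : x + h ∈ ball x δ := by simpa using hh
      have := hK _ hxh
      rw [add_sub_cancel_left] at this
      rcases eq_or_ne h 0 with rfl | hne
      · have : (f - g) (x + 0) = 0 := by simp [f, g]
        rw [this, norm_zero]
        positivity
      have hpos : 0 < ‖h‖ := norm_pos_iff.2 hne
      have hval : (f - g) (x + h) = -(u (x + h) - u x - fderiv ℝ u x h) /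
          ‖h‖ ^ ((N : ℝ) + 2 * s) := by
        simp only [Pi.sub_apply, hg, hf, indicator_of_mem hxh]
        rw [show x - (x + h) = -h by abel, norm_neg, map_neg]
        ring
      rw [hval, norm_div, norm_neg, Real.norm_eq_abs, Real.norm_eq_abs,
        abs_of_nonneg (Real.rpow_nonneg hpos.le _), div_le_iff₀ (by positivity), mul_assoc,
        ← Real.rpow_add hpos]
      rwa [show -((N : ℝ) + 2 * s - 2) + ((N : ℝ) + 2 * s) = (2 : ℕ) by push_cast; ring,
        Real.rpow_natCast]
    have h1 := (measurePreserving_add_left (volume : Measure (EuclideanSpace ℝ (Fin N))) x).integrableOn_comp_preimage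
      (measurableEmbedding_addLeft x) (f := f - g) (s := ball x δ)
    rw [← h1]
    simpa [Function.comp_def] using h0
  have hint : Integrable (f - g) := by
    rw [← integrableOn_univ, ← union_compl_self (ball x δ)]
    refine hball.union ((hcompl δ hδ).congr_fun (fun y hy => ?_) measurableSet_ball.compl)
    simp only [Pi.sub_apply, hg]
    rw [indicator_of_notMem hy, sub_zero]
  refine ⟨fracLapConst N s * ∫ y, (f - g) y, fun ε hε => hcompl ε hε, Tendsto.const_mul _ ?_⟩
  have heq : ∀ ε > 0, ∫ y in (ball x ε)ᶜ, f y = ∫ y, (ball x ε)ᶜ.indicator (f - g) y := by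
    intro ε hε
    have hgi : IntegrableOn g (ball x ε)ᶜ := by
      simpa using (hcompl ε hε).sub hint.integrableOn
    rw [integral_indicator measurableSet_ball.compl, integral_sub' (hcompl ε hε) hgi,
      setIntegral_eq_zero_of_odd_about _ x hodd, sub_zero]
  refine Tendsto.congr' (eventually_nhdsWithin_of_forall fun ε hε => (heq ε hε).symm) ?_
  refine tendsto_integral_filter_of_dominated_convergence (fun y => ‖(f - g) y‖) ?_ ?_ hint.norm ?_
  · exact Eventually.of_forall fun ε =>
      ((hfm.sub hgm).indicator measurableSet_ball.compl).aestronglyMeasurable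
  · exact Eventually.of_forall fun ε => Eventually.of_forall fun y =>
      norm_indicator_le_norm_self _ _
  · refine Eventually.of_forall fun y => ?_
    rcases eq_or_ne y x with rfl | hne
    · have h0 : (f - g) y = 0 := by simp [f, g]
      rw [h0]
      exact tendsto_const_nhds.congr fun ε => (indicator_apply_eq_zero.2 fun _ => h0).symm
    · refine tendsto_const_nhds.congr' ?_
      filter_upwards [Ioo_mem_nhdsGT (dist_pos.2 hne)] with ε hε
      rw [indicator_of_mem]
      simpa using hε.2.le

/-! ### Pointwise inequalities for a pair of inverse points -/

lemma convexOn_rpow_neg {a : ℝ} (ha : 0 < a) : ConvexOn ℝ (Ioi 0) fun t : ℝ => t ^ (-a) := by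
  have h : ConvexOn ℝ (Ioi 0) fun t : ℝ => -a * Real.log t :=
    (strictConcaveOn_log_Ioi.concaveOn.neg.smul ha.le).congr fun t _ => by simp
  have h2 := (convexOn_exp.subset (subset_univ _) ?_).comp h (Real.exp_monotone.monotoneOn _)
  · refine h2.congr fun t (ht : 0 < t) => ?_
    simp [Function.comp, Real.rpow_def_of_pos ht, mul_comm]
  · exact isPreconnected_Ioi.image _ (by
      intro t (ht : 0 < t)
      exact (continuousAt_const.mul (Real.continuousAt_log ht.ne')).continuousWithinAt)
      |>.ordConnected.convex

/-- The gain of `(1 + r)^(-a)` over its values at the radii `ρ = r / τ` and `r²/ρ = r τ`. -/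
lemma kelvin_gain_nonneg {a γ r τ : ℝ} (ha : 0 < a) (haγ : a ≤ γ) (hr : 0 < r) (hτ : 0 < τ)
    (hτ1 : τ ≤ 1) :
    0 ≤ (1 + r) ^ (-a) - (1 + r / τ) ^ (-a) - τ ^ γ * ((1 + r * τ) ^ (-a) - (1 + r) ^ (-a)) := by
  have hc := convexOn_rpow_neg ha
  have hA : τ * (1 + r) ∈ Ioi (0 : ℝ) := by simp only [mem_Ioi]; positivity
  have hB : 1 + r ∈ Ioi (0 : ℝ) := by simp only [mem_Ioi]; positivity
  -- The points τ + r and 1 + rτ lie between τ(1+r) and 1+r and have the same sum as these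
  -- endpoints; convexity therefore compares the two sums of values.
  have hw : (1 : ℝ) / (1 + r) + r / (1 + r) = 1 := by field_simp
  have h1 := hc.2 hA hB (by positivity) (by positivity) hw
  have h2 := hc.2 hB hA (by positivity) (by positivity) hw
  simp only [smul_eq_mul] at h1 h2
  rw [show 1 / (1 + r) * (τ * (1 + r)) + r / (1 + r) * (1 + r) = τ + r by field_simp] at h1
  rw [show 1 / (1 + r) * (1 + r) + r / (1 + r) * (τ * (1 + r)) = 1 + r * τ by field_simp] at h2
  have h3 : (τ + r) ^ (-a) + (1 + r * τ) ^ (-a) ≤ (τ * (1 + r)) ^ (-a) + (1 + r) ^ (-a) := by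
    have e : r / (1 + r) = 1 - 1 / (1 + r) := by field_simp; ring
    rw [e] at h1 h2
    linarith
  rw [Real.mul_rpow hτ.le (by positivity), Real.rpow_neg hτ.le] at h3
  have h4 : (1 + r / τ) ^ (-a) = τ ^ a * (τ + r) ^ (-a) := by
    rw [show 1 + r / τ = τ⁻¹ * (τ + r) by field_simp,
      Real.mul_rpow (by positivity) (by positivity), Real.inv_rpow hτ.le, Real.rpow_neg hτ.le,
      inv_inv]
  -- The convexity estimate is the case γ = a; a larger γ only shrinks the loss.
  have h5 : τ ^ γ ≤ τ ^ a := Real.rpow_le_rpow_of_exponent_ge hτ hτ1 haγ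
  have h6 : (1 + r) ^ (-a) ≤ (1 + r * τ) ^ (-a) :=
    Real.rpow_le_rpow_of_nonpos (by positivity) (by nlinarith) (by linarith)
  have h7 : 0 < τ ^ a := by positivity
  have h8 := mul_le_mul_of_nonneg_left h3 h7.le
  have h9 : τ ^ a * ((τ ^ a)⁻¹ * (1 + r) ^ (-a)) = (1 + r) ^ (-a) := by field_simp
  rw [mul_add, mul_add, h9] at h8
  rw [h4]
  nlinarith [mul_le_mul_of_nonneg_right h5 (sub_nonneg.2 h6)]

/-- Far out, each negative term costs at most a quarter of (1+r)^(-a): the outer value by the factor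
M^(-a), the inner one by τ^(γ-a) ≤ M^(-(γ-a)), using 1 + rτ ≥ τ(1+r). -/
lemma kelvin_gain_lower_bound {a γ r τ M : ℝ} (ha : 0 < a) (haγ : a < γ) (hr : 0 < r) (hτ : 0 < τ)
    (hM : 1 ≤ M) (hM1 : M ^ (-a) ≤ 1 / 4) (hM2 : M ^ (-(γ - a)) ≤ 1 / 4)
    (hρ : M * (1 + r) ≤ r / τ) :
    (1 + r) ^ (-a) / 2 ≤
      (1 + r) ^ (-a) - (1 + r / τ) ^ (-a) - τ ^ γ * ((1 + r * τ) ^ (-a) - (1 + r) ^ (-a)) := by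
  have hM0 : 0 < M := by linarith
  have hA : 0 < (1 + r) ^ (-a) := by positivity
  have hτM : τ ≤ M⁻¹ := by
    rw [le_div_iff₀ hτ] at hρ
    rw [← one_div, le_div_iff₀ hM0]
    nlinarith [mul_pos hM0 hτ]
  have hτ1 : τ ≤ 1 := hτM.trans (inv_le_one_of_one_le₀ hM)
  have h1 : (1 + r / τ) ^ (-a) ≤ 1 / 4 * (1 + r) ^ (-a) := by
    calc (1 + r / τ) ^ (-a) ≤ (M * (1 + r)) ^ (-a) :=
          Real.rpow_le_rpow_of_nonpos (by positivity) (by linarith) (by linarith)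
      _ = M ^ (-a) * (1 + r) ^ (-a) := Real.mul_rpow hM0.le (by positivity)
      _ ≤ _ := by gcongr
  have h2 : τ ^ γ * (1 + r * τ) ^ (-a) ≤ 1 / 4 * (1 + r) ^ (-a) := by
    calc τ ^ γ * (1 + r * τ) ^ (-a) ≤ τ ^ γ * (τ * (1 + r)) ^ (-a) := by
          refine mul_le_mul_of_nonneg_left (Real.rpow_le_rpow_of_nonpos (by positivity) ?_
            (by linarith)) (by positivity)
          nlinarith
      _ = τ ^ (γ - a) * (1 + r) ^ (-a) := by
          rw [Real.mul_rpow hτ.le (by positivity), ← mul_assoc, ← Real.rpow_add hτ, sub_eq_add_neg]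
      _ ≤ M⁻¹ ^ (γ - a) * (1 + r) ^ (-a) := by
          gcongr
      _ = M ^ (-(γ - a)) * (1 + r) ^ (-a) := by
          rw [Real.inv_rpow hM0.le, Real.rpow_neg hM0.le]
      _ ≤ _ := by gcongr
  have h3 : 0 < τ ^ γ * (1 + r) ^ (-a) := by positivity
  linarith

lemma exists_rpow_neg_le {a b : ℝ} (ha : 0 < a) (hb : 0 < b) :
    ∃ M : ℝ, 2 ≤ M ∧ M ^ (-a) ≤ 1 / 4 ∧ M ^ (-b) ≤ 1 / 4 := by
  have h := fun c (hc : (0 : ℝ) < c) =>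
    (tendsto_rpow_neg_atTop hc).eventually (Iic_mem_nhds (show (0 : ℝ) < 1 / 4 by norm_num))
  obtain ⟨M, h1, h2, h3⟩ := ((eventually_ge_atTop (2 : ℝ)).and ((h a ha).and (h b hb))).exists
  exact ⟨M, h1, h2, h3⟩

/-! ### Change of variables by inversion -/

open EuclideanGeometry in
-- Inversion scales the distance to x by |x|/|z|, which turns the truncation at ε into the condition
-- on z. The origin is not the image of any outer point.
lemma image_inversion_eq {E : Type*} [NormedAddCommGroup E] [InnerProductSpace ℝ E] {x : E}
    (hx : x ≠ 0) (ε : ℝ) :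
    inversion (0 : E) ‖x‖ '' {z | ‖x‖ < ‖z‖ ∧ ε ≤ ‖x‖ / ‖z‖ * ‖x - z‖} =
      ((ball x ε)ᶜ ∩ ball 0 ‖x‖) \ {0} := by
  have hr : ‖x‖ ≠ 0 := norm_ne_zero_iff.2 hx
  have hr0 : 0 < ‖x‖ := norm_pos_iff.2 hx
  rw [(inversion_involutive (0 : E) hr).image_eq_preimage_symm]
  ext y
  rcases eq_or_ne y 0 with rfl | hy
  · simp
  have hy0 : 0 < ‖y‖ := norm_pos_iff.2 hy
  have h1 : ‖inversion (0 : E) ‖x‖ y‖ = ‖x‖ ^ 2 / ‖y‖ := by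
    simpa using dist_inversion_center (0 : E) y ‖x‖
  have h2 : ‖x - inversion (0 : E) ‖x‖ y‖ * ‖y‖ = ‖x‖ * ‖x - y‖ := by
    have := dist_inversion_mul_dist_center_eq (R := ‖x‖) hy hx
    rw [inversion_of_mem_sphere (show x ∈ sphere (0 : E) ‖x‖ by simp)] at this
    simp only [dist_eq_norm, sub_zero] at this
    rw [norm_sub_rev, this, norm_sub_rev y x, mul_comm]
  have h3 : ‖x - inversion (0 : E) ‖x‖ y‖ = ‖x‖ * ‖x - y‖ / ‖y‖ := by
    rw [eq_div_iff hy0.ne', h2]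
  simp only [mem_preimage, mem_ofPred_eq, Set.mem_sdiff, mem_inter_iff, mem_compl_iff, mem_ball,
    mem_singleton_iff, hy, not_false_eq_true, and_true, h1, h3, dist_eq_norm, sub_zero, not_lt]
  rw [show ‖x‖ / (‖x‖ ^ 2 / ‖y‖) * (‖x‖ * ‖x - y‖ / ‖y‖) = ‖x - y‖ by field_simp,
    lt_div_iff₀ hy0, norm_sub_rev y x, and_comm, sq, mul_lt_mul_iff_right₀ hr0]

open EuclideanGeometry in
-- The derivative is a reflection, of determinant ±1, times a scalar.
lemma abs_det_fderiv_inversion {E : Type*} [NormedAddCommGroup E] [InnerProductSpace ℝ E]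
    [FiniteDimensional ℝ E] (r : ℝ) (z : E) :
    |((r / dist z 0) ^ 2 • ((ℝ ∙ (z - 0))ᗮ.reflection : E →L[ℝ] E)).det| =
      (|r| / ‖z‖) ^ (2 * Module.finrank ℝ E) := by
  have h : LinearMap.det (((ℝ ∙ (z - 0))ᗮ.reflection : E →L[ℝ] E) : E →ₗ[ℝ] E) =
      (-1) ^ Module.finrank ℝ (ℝ ∙ (z - 0))ᗮᗮ := Submodule.det_reflection _
  rw [ContinuousLinearMap.det, ContinuousLinearMap.toLinearMap_smul, LinearMap.det_smul, h]
  simp [abs_mul, abs_pow, abs_div, pow_mul]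

lemma measurableSet_norm_lt_and_le {N : ℕ} (x : EuclideanSpace ℝ (Fin N)) (ε : ℝ) :
    MeasurableSet {z | ‖x‖ < ‖z‖ ∧ ε ≤ ‖x‖ / ‖z‖ * ‖x - z‖} := by
  have h : Measurable fun z => ‖x‖ / ‖z‖ * ‖x - z‖ := by fun_prop
  exact (measurableSet_lt measurable_const measurable_norm).inter
    (measurableSet_le measurable_const h)

open EuclideanGeometry in
lemma setIntegral_compl_ball_inter_ball {N : ℕ} {x : EuclideanSpace ℝ (Fin N)} (hN : 1 ≤ N)
    (hx : x ≠ 0) (ε : ℝ) (f : EuclideanSpace ℝ (Fin N) → ℝ)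
    (hf : IntegrableOn f (ball x ε)ᶜ) :
    IntegrableOn (fun z => (‖x‖ / ‖z‖) ^ (2 * N) * f (inversion 0 ‖x‖ z))
      {z | ‖x‖ < ‖z‖ ∧ ε ≤ ‖x‖ / ‖z‖ * ‖x - z‖} ∧
    ∫ y in (ball x ε)ᶜ ∩ ball 0 ‖x‖, f y =
      ∫ z in {z | ‖x‖ < ‖z‖ ∧ ε ≤ ‖x‖ / ‖z‖ * ‖x - z‖},
        (‖x‖ / ‖z‖) ^ (2 * N) * f (inversion 0 ‖x‖ z) := by
  have : Nonempty (Fin N) := ⟨⟨0, hN⟩⟩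
  set P : Set (EuclideanSpace ℝ (Fin N)) := {z | ‖x‖ < ‖z‖ ∧ ε ≤ ‖x‖ / ‖z‖ * ‖x - z‖}
  have hP : MeasurableSet P :=
    measurableSet_norm_lt_and_le x ε
  have hr : ‖x‖ ≠ 0 := norm_ne_zero_iff.2 hx
  have hderiv : ∀ z ∈ P, HasFDerivWithinAt (inversion (0 : EuclideanSpace ℝ (Fin N)) ‖x‖)
      ((‖x‖ / dist z 0) ^ 2 • ((ℝ ∙ (z - 0))ᗮ.reflection : EuclideanSpace ℝ (Fin N) →L[ℝ] _))
      P z := fun z hz =>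
    (hasFDerivAt_inversion (norm_ne_zero_iff.1 ((norm_nonneg x).trans_lt hz.1).ne')).hasFDerivWithinAt
  have hinj := (inversion_injective (0 : EuclideanSpace ℝ (Fin N)) hr).injOn (s := P)
  have hae : ((ball x ε)ᶜ ∩ ball 0 ‖x‖ : Set (EuclideanSpace ℝ (Fin N))) =ᵐ[volume]
      inversion 0 ‖x‖ '' P := by
    rw [image_inversion_eq hx]
    exact (sdiff_null_ae_eq_self (measure_singleton _)).symm
  have h1 := integrableOn_image_iff_integrableOn_abs_det_fderiv_smul volume hP hderiv hinj f
  have h2 := integral_image_eq_integral_abs_det_fderiv_smul volume hP hderiv hinj f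
  simp only [abs_det_fderiv_inversion, abs_norm, finrank_euclideanSpace, Fintype.card_fin,
    smul_eq_mul] at h1 h2
  refine ⟨h1.1 ?_, ?_⟩
  · rw [image_inversion_eq hx]
    exact hf.mono_set (sdiff_subset.trans inter_subset_left)
  · rw [setIntegral_congr_set hae, h2]

open EuclideanGeometry in
-- The Jacobian τ^(2N) divided by the kernel factor τ^(N+2s) leaves τ^(N-2s).
lemma kelvin_pair_eq {N : ℕ} {s a : ℝ} {x z : EuclideanSpace ℝ (Fin N)} (hx : x ≠ 0)
    (hz : ‖x‖ < ‖z‖) :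
    ((1 + ‖x‖) ^ (-a) - (1 + ‖z‖) ^ (-a)) / ‖x - z‖ ^ ((N : ℝ) + 2 * s) +
      (‖x‖ / ‖z‖) ^ (2 * N) * (((1 + ‖x‖) ^ (-a) - (1 + ‖inversion 0 ‖x‖ z‖) ^ (-a)) /
        ‖x - inversion 0 ‖x‖ z‖ ^ ((N : ℝ) + 2 * s)) =
    ((1 + ‖x‖) ^ (-a) - (1 + ‖x‖ / (‖x‖ / ‖z‖)) ^ (-a) - (‖x‖ / ‖z‖) ^ ((N : ℝ) - 2 * s) *
      ((1 + ‖x‖ * (‖x‖ / ‖z‖)) ^ (-a) - (1 + ‖x‖) ^ (-a))) / ‖x - z‖ ^ ((N : ℝ) + 2 * s) := by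
  have hr0 : 0 < ‖x‖ := norm_pos_iff.2 hx
  have hz0 : 0 < ‖z‖ := hr0.trans hz
  have hxz : 0 < ‖x - z‖ := norm_pos_iff.2 (sub_ne_zero.2 (by rintro rfl; exact hz.false))
  have h1 : ‖inversion (0 : EuclideanSpace ℝ (Fin N)) ‖x‖ z‖ = ‖x‖ * (‖x‖ / ‖z‖) := by
    rw [← mul_div_assoc, ← sq]
    simpa using dist_inversion_center (0 : EuclideanSpace ℝ (Fin N)) z ‖x‖
  have h3 : ‖x - inversion (0 : EuclideanSpace ℝ (Fin N)) ‖x‖ z‖ = ‖x‖ / ‖z‖ * ‖x - z‖ := by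
    have := dist_inversion_mul_dist_center_eq (R := ‖x‖) (norm_pos_iff.1 hz0) hx
    rw [inversion_of_mem_sphere (show x ∈ sphere (0 : EuclideanSpace ℝ (Fin N)) ‖x‖ by simp)]
      at this
    simp only [dist_eq_norm, sub_zero] at this
    rw [norm_sub_rev, div_mul_eq_mul_div, eq_div_iff hz0.ne', this, norm_sub_rev z x, mul_comm]
  rw [h1, h3, div_div_cancel₀ hr0.ne']
  set τ := ‖x‖ / ‖z‖
  have hτ : 0 < τ := by positivity
  have h4 : τ ^ (2 * N) = τ ^ ((N : ℝ) - 2 * s) * τ ^ ((N : ℝ) + 2 * s) := by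
    rw [← Real.rpow_add hτ, ← Real.rpow_natCast]
    congr 1
    push_cast; ring
  rw [Real.mul_rpow hτ.le hxz.le, h4]
  field_simp
  ring

/-! ### Lower bound for the fractional Laplacian -/

/-- Lower bound for the truncated integrals defining `(-Δ)^s (1 + |x|)^(-a)`. -/
lemma exists_truncated_integral_lower_bound {N : ℕ} {s a : ℝ} (hN : 1 ≤ N) (hs : 0 < s)
    (ha : 0 < a) (haN : a < N - 2 * s) :
    ∃ c : ℝ, 0 < c ∧ ∀ x : EuclideanSpace ℝ (Fin N), x ≠ 0 → ∀ᶠ ε in 𝓝[>] (0 : ℝ),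
      c * (1 + ‖x‖) ^ (-a - 2 * s) ≤ ∫ y in (ball x ε)ᶜ,
        ((1 + ‖x‖) ^ (-a) - (1 + ‖y‖) ^ (-a)) / ‖x - y‖ ^ ((N : ℝ) + 2 * s) := by
  obtain ⟨M, hM, hM1, hM2⟩ := exists_rpow_neg_le ha (sub_pos.2 haN)
  have hω : 0 < volume.real (ball (0 : EuclideanSpace ℝ (Fin N)) 1) :=
    ENNReal.toReal_pos (measure_ball_pos _ _ one_pos).ne' measure_ball_lt_top.ne
  refine ⟨volume.real (ball (0 : EuclideanSpace ℝ (Fin N)) 1) / 2 /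
    (M + 3) ^ ((N : ℝ) + 2 * s), by positivity, fun x hx => ?_⟩
  have hr : 0 < ‖x‖ := norm_pos_iff.2 hx
  -- For ε below this threshold the test ball around `z₀` lies inside `P`.
  have hthr : 0 < ‖x‖ * ((M - 1) / (M + 2)) := mul_pos hr (div_pos (by linarith) (by linarith))
  filter_upwards [Ioo_mem_nhdsGT hthr] with ε hε
  set f : EuclideanSpace ℝ (Fin N) → ℝ :=
    fun y => ((1 + ‖x‖) ^ (-a) - (1 + ‖y‖) ^ (-a)) / ‖x - y‖ ^ ((N : ℝ) + 2 * s) with hf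
  have hfint : IntegrableOn f (ball x ε)ᶜ := by
    refine integrableOn_diffQuot_compl_ball hs
      (u := fun y : EuclideanSpace ℝ (Fin N) => (1 + ‖y‖) ^ (-a)) (M := 1) (by fun_prop)
      (fun y => ?_) x hε.1
    rw [abs_of_nonneg (by positivity)]
    exact Real.rpow_le_one_of_one_le_of_nonpos (by linarith [norm_nonneg y]) (by linarith)
  set P : Set (EuclideanSpace ℝ (Fin N)) := {z | ‖x‖ < ‖z‖ ∧ ε ≤ ‖x‖ / ‖z‖ * ‖x - z‖} with hPdef
  have hP : MeasurableSet P :=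
    measurableSet_norm_lt_and_le x ε
  obtain ⟨hgi, hg⟩ := setIntegral_compl_ball_inter_ball hN hx ε f hfint
  have hPout : P ⊆ (ball x ε)ᶜ \ ball 0 ‖x‖ := by
    rintro z ⟨hz1, hz2⟩
    have : ‖x‖ / ‖z‖ ≤ 1 := (div_le_one (hr.trans hz1)).2 hz1.le
    refine ⟨?_, by simpa using hz1.le⟩
    simp only [mem_compl_iff, mem_ball, dist_eq_norm, not_lt, norm_sub_rev z x]
    exact hz2.trans (mul_le_of_le_one_left (norm_nonneg _) this)
  have hfP : IntegrableOn f P := hfint.mono_set (hPout.trans sdiff_subset)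
  -- The truncation is not invariant under inversion, but the unpaired outer points contribute
  -- nonnegatively because the profile is radially decreasing.
  have hout : ∫ y in P, f y ≤ ∫ y in (ball x ε)ᶜ \ ball 0 ‖x‖, f y := by
    refine setIntegral_mono_set (hfint.mono_set sdiff_subset) ?_ hPout.eventuallyLE
    refine (ae_restrict_iff' (measurableSet_ball.compl.diff measurableSet_ball)).2
      (Eventually.of_forall fun y hy => ?_)
    have hy2 : ‖x‖ ≤ ‖y‖ := by simpa using hy.2
    refine div_nonneg (sub_nonneg.2 ?_) (by positivity)
    exact Real.rpow_le_rpow_of_nonpos (by positivity) (by linarith) (by linarith)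
  have hsplit := integral_inter_add_sdiff (measurableSet_ball (x := (0 : EuclideanSpace ℝ (Fin N)))
    (ε := ‖x‖)) hfint
  rw [← hsplit, hg]
  refine le_trans ?_ (add_le_add_right hout _)
  rw [← integral_add hgi hfP]
  set h : EuclideanSpace ℝ (Fin N) → ℝ := fun z =>
    (‖x‖ / ‖z‖) ^ (2 * N) * f (EuclideanGeometry.inversion 0 ‖x‖ z) + f z with hh
  have hhi : IntegrableOn h P := hgi.add hfP
  have hheq : ∀ z ∈ P, h z = ((1 + ‖x‖) ^ (-a) - (1 + ‖x‖ / (‖x‖ / ‖z‖)) ^ (-a) -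
      (‖x‖ / ‖z‖) ^ ((N : ℝ) - 2 * s) * ((1 + ‖x‖ * (‖x‖ / ‖z‖)) ^ (-a) - (1 + ‖x‖) ^ (-a))) /
        ‖x - z‖ ^ ((N : ℝ) + 2 * s) := fun z hz => by
    rw [← kelvin_pair_eq hx hz.1, add_comm]
  have hnonneg : ∀ z ∈ P, 0 ≤ h z := fun z hz => by
    have hz0 : 0 < ‖z‖ := hr.trans hz.1
    rw [hheq z hz]
    exact div_nonneg (kelvin_gain_nonneg ha haN.le hr (by positivity)
      ((div_le_one hz0).2 hz.1.le)) (by positivity)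
  have hR : 0 < 1 + ‖x‖ := by positivity
  -- Radius 1+|x| around a point of norm (M+1)(1+|x|): every distance is comparable to 1+|x|, and
  -- volume over kernel gives (1+|x|)^(-2s).
  set z₀ : EuclideanSpace ℝ (Fin N) := ((M + 1) * (1 + ‖x‖) / ‖x‖) • x with hz₀
  have hz₀n : ‖z₀‖ = (M + 1) * (1 + ‖x‖) := by
    rw [hz₀, norm_smul, Real.norm_of_nonneg (by positivity)]
    field_simp
  have hQ : ∀ z ∈ ball z₀ (1 + ‖x‖), M * (1 + ‖x‖) ≤ ‖z‖ ∧ ‖z‖ ≤ (M + 2) * (1 + ‖x‖) ∧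
      ‖x - z‖ ≤ (M + 3) * (1 + ‖x‖) ∧ (M - 1) * (1 + ‖x‖) ≤ ‖x - z‖ := fun z hz => by
    rw [mem_ball, dist_eq_norm] at hz
    have h1 := norm_sub_norm_le z₀ z
    have h2 := norm_sub_norm_le z z₀
    have h3 := norm_sub_norm_le z x
    have h4 := norm_sub_le x z
    rw [norm_sub_rev] at h1 h3
    refine ⟨?_, ?_, ?_, ?_⟩ <;> linarith
  have hQP : ball z₀ (1 + ‖x‖) ⊆ P := fun z hz => by
    obtain ⟨h1, h2, h3, h4⟩ := hQ z hz
    have hz1 : ‖x‖ < ‖z‖ := by nlinarith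
    refine ⟨hz1, hε.2.le.trans ?_⟩
    rw [div_mul_eq_mul_div, mul_div_assoc]
    refine mul_le_mul_of_nonneg_left ?_ hr.le
    rw [div_le_div_iff₀ (by linarith) (hr.trans hz1)]
    calc (M - 1) * ‖z‖ ≤ (M - 1) * ((M + 2) * (1 + ‖x‖)) :=
          mul_le_mul_of_nonneg_left h2 (by linarith)
      _ = (M - 1) * (1 + ‖x‖) * (M + 2) := by ring
      _ ≤ _ := mul_le_mul_of_nonneg_right h4 (by linarith)
  have hvol : volume.real (ball z₀ (1 + ‖x‖)) =
      (1 + ‖x‖) ^ N * volume.real (ball (0 : EuclideanSpace ℝ (Fin N)) 1) := by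
    rw [measureReal_def, Measure.addHaar_ball_of_pos _ _ hR, ENNReal.toReal_mul,
      ENNReal.toReal_ofReal (by positivity), finrank_euclideanSpace, Fintype.card_fin,
      measureReal_def]
  calc _ = ∫ _ in ball z₀ (1 + ‖x‖), (1 + ‖x‖) ^ (-a) / 2 /
        ((M + 3) * (1 + ‖x‖)) ^ ((N : ℝ) + 2 * s) := by
        rw [setIntegral_const, smul_eq_mul, hvol,
          Real.mul_rpow (by linarith) hR.le, Real.rpow_add hR, Real.rpow_sub hR,
          Real.rpow_natCast]
        field_simp
    _ ≤ ∫ z in ball z₀ (1 + ‖x‖), h z := by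
        refine setIntegral_mono_on (integrableOn_const measure_ball_lt_top.ne)
          (hhi.mono_set hQP) measurableSet_ball fun z hz => ?_
        obtain ⟨h1, h2, h3, h4⟩ := hQ z hz
        have hz0 : 0 < ‖z‖ := hr.trans (hQP hz).1
        rw [hheq z (hQP hz)]
        have hxz : 0 < ‖x - z‖ := lt_of_lt_of_le (mul_pos (by linarith) hR) h4
        have := kelvin_gain_lower_bound (τ := ‖x‖ / ‖z‖) ha haN hr (by positivity) (by linarith)
          hM1 hM2 (by rwa [div_div_cancel₀ hr.ne'])
        refine div_le_div₀ (le_trans (by positivity) this) this (by positivity) ?_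
        exact Real.rpow_le_rpow hxz.le h3 (by positivity)
    _ ≤ ∫ z in P, h z :=
        setIntegral_mono_set hhi ((ae_restrict_iff' hP).2 (Eventually.of_forall hnonneg))
          hQP.eventuallyLE

/-! ### From the lower bound to supersolutions -/

lemma fracLapConst_pos {N : ℕ} {s : ℝ} (hs0 : 0 < s) (hs1 : s < 1) : 0 < fracLapConst N s := by
  unfold fracLapConst
  have h1 : 0 < Real.Gamma ((N : ℝ) / 2 + s) := Real.Gamma_pos_of_pos (by positivity)
  have h2 : 0 < Real.Gamma (1 - s) := Real.Gamma_pos_of_pos (by linarith)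
  positivity

lemma HasFracLap.const_mul {N : ℕ} {s : ℝ} {u : EuclideanSpace ℝ (Fin N) → ℝ}
    {x : EuclideanSpace ℝ (Fin N)} {L : ℝ} (h : HasFracLap s u x L) (C : ℝ) :
    HasFracLap s (fun y => C * u y) x (C * L) := by
  have e : ∀ y, (C * u x - C * u y) / ‖x - y‖ ^ ((N : ℝ) + 2 * s) =
      C * ((u x - u y) / ‖x - y‖ ^ ((N : ℝ) + 2 * s)) := fun y => by ring
  refine ⟨fun ε hε => ?_, ?_⟩
  · simp_rw [e]
    exact (h.1 ε hε).const_mul C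
  · simp_rw [e, integral_const_mul]
    exact (h.2.const_mul C).congr fun ε => by ring

lemma memL2s_of_bounded {N : ℕ} {s : ℝ} (hs : 0 < s) {u : EuclideanSpace ℝ (Fin N) → ℝ}
    (hu : Measurable u) {M : ℝ} (hM : ∀ x, |u x| ≤ M) : MemL2s s u := by
  have hm : (0 : ℝ) ≤ (N : ℝ) + 2 * s := by positivity
  have hfr : (Module.finrank ℝ (EuclideanSpace ℝ (Fin N)) : ℝ) < (N : ℝ) + 2 * s := by
    simp; linarith
  have hM0 : 0 ≤ M := (abs_nonneg _).trans (hM 0)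
  refine Integrable.mono' ((integrable_one_add_norm
    (μ := (volume : Measure (EuclideanSpace ℝ (Fin N)))) hfr).const_mul
      (M * 2 ^ ((N : ℝ) + 2 * s))) ?_ (Eventually.of_forall fun x => ?_)
  · have : Measurable fun x => u x / (1 + ‖x‖ ^ ((N : ℝ) + 2 * s)) := by fun_prop
    exact this.aestronglyMeasurable
  have hx := norm_nonneg x
  have h0 : 0 < 1 + ‖x‖ ^ ((N : ℝ) + 2 * s) := by positivity
  have h : (1 + ‖x‖) ^ ((N : ℝ) + 2 * s) ≤
      2 ^ ((N : ℝ) + 2 * s) * (1 + ‖x‖ ^ ((N : ℝ) + 2 * s)) := by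
    rcases le_total ‖x‖ 1 with h1 | h1
    · calc (1 + ‖x‖) ^ ((N : ℝ) + 2 * s) ≤ 2 ^ ((N : ℝ) + 2 * s) * 1 := by
            rw [mul_one]
            exact Real.rpow_le_rpow (by positivity) (by linarith) hm
        _ ≤ _ := by
            gcongr
            linarith [Real.rpow_nonneg hx ((N : ℝ) + 2 * s)]
    · calc (1 + ‖x‖) ^ ((N : ℝ) + 2 * s) ≤ (2 * ‖x‖) ^ ((N : ℝ) + 2 * s) :=
            Real.rpow_le_rpow (by positivity) (by linarith) hm
        _ = 2 ^ ((N : ℝ) + 2 * s) * ‖x‖ ^ ((N : ℝ) + 2 * s) := Real.mul_rpow (by norm_num) hx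
        _ ≤ _ := by
            gcongr
            linarith
  rw [norm_div, Real.norm_eq_abs, Real.norm_of_nonneg h0.le, Real.rpow_neg (by positivity),
    div_le_iff₀ h0, mul_assoc, mul_assoc]
  refine (hM x).trans (le_mul_of_one_le_right hM0 ?_)
  rw [← mul_assoc, mul_right_comm, ← div_eq_mul_inv, one_le_div (by positivity)]
  exact h

lemma abs_one_add_norm_rpow_neg_le_one {N : ℕ} {a : ℝ} (ha : 0 ≤ a)
    (x : EuclideanSpace ℝ (Fin N)) : |(1 + ‖x‖) ^ (-a)| ≤ 1 := by
  rw [abs_of_nonneg (by positivity)]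
  exact Real.rpow_le_one_of_one_le_of_nonpos (by linarith [norm_nonneg x]) (by linarith)

lemma contDiffAt_one_add_norm_rpow {N : ℕ} (a : ℝ) {x : EuclideanSpace ℝ (Fin N)} (hx : x ≠ 0) :
    ContDiffAt ℝ 2 (fun y : EuclideanSpace ℝ (Fin N) => (1 + ‖y‖) ^ a) x :=
  (contDiffAt_const.add (contDiffAt_norm ℝ hx)).rpow_const_of_ne (by positivity)

/-- `(-Δ)^s (1 + |x|)^(-a) ≥ c (1 + |x|)^(-a - 2s)` away from the origin if `0 < a < N - 2s`. -/
theorem exists_hasFracLap_ge {N : ℕ} {s a : ℝ} (hN : 1 ≤ N) (hs0 : 0 < s) (hs1 : s < 1)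
    (ha : 0 < a) (haN : a < N - 2 * s) :
    ∃ c : ℝ, 0 < c ∧ ∀ x : EuclideanSpace ℝ (Fin N), x ≠ 0 → ∃ L : ℝ,
      HasFracLap s (fun y : EuclideanSpace ℝ (Fin N) => (1 + ‖y‖) ^ (-a)) x L ∧
      c * (1 + ‖x‖) ^ (-a - 2 * s) ≤ L := by
  obtain ⟨c, hc, h⟩ := exists_truncated_integral_lower_bound hN hs0 ha haN
  have hC := fracLapConst_pos (N := N) hs0 hs1
  refine ⟨fracLapConst N s * c, by positivity, fun x hx => ?_⟩
  obtain ⟨L, hL⟩ := exists_hasFracLap hs0 hs1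
    (u := fun y : EuclideanSpace ℝ (Fin N) => (1 + ‖y‖) ^ (-a)) (by fun_prop)
    (abs_one_add_norm_rpow_neg_le_one ha.le) hN (contDiffAt_one_add_norm_rpow (-a) hx)
  refine ⟨L, hL, ge_of_tendsto hL.2 ?_⟩
  filter_upwards [h x hx] with ε hε
  rw [mul_assoc]
  exact mul_le_mul_of_nonneg_left hε hC.le

theorem exists_const_isClassicalSupersolution {N : ℕ} {s p a : ℝ} (hN : 1 ≤ N) (hs0 : 0 < s)
    (hs1 : s < 1) (hp : 1 < p) (ha : 0 < a) (haN : a < N - 2 * s) (hap : 2 * s ≤ a * (p - 1)) :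
    ∃ C : ℝ, 0 < C ∧ ∀ q lam R₀ : ℝ, lam ≤ 1 → 0 < R₀ →
      IsClassicalSupersolution s q lam (fun t : ℝ => t ^ p) R₀
        (fun x : EuclideanSpace ℝ (Fin N) => C * (1 + ‖x‖) ^ (-a)) := by
  obtain ⟨c, hc, h⟩ := exists_hasFracLap_ge hN hs0 hs1 ha haN
  set C := c ^ (1 / (p - 1)) with hCdef
  have hC : 0 < C := by positivity
  have hCp : C ^ p = C * c := by
    have h1 : C ^ (p - 1) = c := by
      rw [hCdef, ← Real.rpow_mul hc.le, one_div_mul_cancel (by linarith), Real.rpow_one]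
    rw [show p = 1 + (p - 1) by ring, Real.rpow_add hC, Real.rpow_one, h1]
  have hne : ∀ R₀ : ℝ, 0 < R₀ → ∀ x ∈ (ball (0 : EuclideanSpace ℝ (Fin N)) R₀)ᶜ, x ≠ 0 := by
    rintro R₀ hR₀ _ hx rfl
    exact hx (mem_ball_self hR₀)
  refine ⟨C, hC, fun q lam R₀ hlam hR₀ => ⟨?_, fun x hx => ?_, fun x hx => ?_⟩⟩
  · refine memL2s_of_bounded hs0 (M := C) (by fun_prop) fun x => ?_
    rw [abs_mul, abs_of_pos hC]
    exact mul_le_of_le_one_right hC.le (abs_one_add_norm_rpow_neg_le_one ha.le x)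
  · exact contDiffAt_const.mul (contDiffAt_one_add_norm_rpow (-a) (hne R₀ hR₀ x hx))
  · obtain ⟨L, hL, hcL⟩ := h x (hne R₀ hR₀ x hx)
    refine ⟨C * L, hL.const_mul C, ?_⟩
    have hx1 : 1 ≤ 1 + ‖x‖ := by linarith [norm_nonneg x]
    have hpow : (C * (1 + ‖x‖) ^ (-a)) ^ p ≤ C * L := by
      rw [Real.mul_rpow hC.le (by positivity), hCp, ← Real.rpow_mul (by positivity), mul_assoc]
      refine mul_le_mul_of_nonneg_left (le_trans (mul_le_mul_of_nonneg_left ?_ hc.le) hcL) hC.le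
      -- The base is at least 1 and -ap ≤ -a - 2s is `hap`.
      exact Real.rpow_le_rpow_of_exponent_le hx1 (by linarith)
    have hgrad : 0 ≤ ‖gradient (fun x : EuclideanSpace ℝ (Fin N) => C * (1 + ‖x‖) ^ (-a)) x‖ ^ q :=
      by positivity
    have hu0 : 0 ≤ (C * (1 + ‖x‖) ^ (-a)) ^ p := by positivity
    have := mul_le_mul_of_nonneg_right hlam hu0
    linarith

end

theorem theorem4 (N : ℕ) (s p : ℝ) (hs0 : 0 < s) (hs1 : s < 1) (hN : 2 * s < (N : ℝ))
    (hp : (N : ℝ) / ((N : ℝ) - 2 * s) < p) :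
    (∃ u : EuclideanSpace ℝ (Fin N) → ℝ,
      (∀ x, 0 < u x) ∧ (∃ M : ℝ, ∀ x, u x ≤ M) ∧
      ∀ q lam R₀ : ℝ, 0 ≤ q → lam ≤ 1 → 0 < R₀ →
        IsClassicalSupersolution s q lam (fun t : ℝ => t ^ p) R₀ u) ∧
    (Set.Ioo (1 / (p - 1)) (((N : ℝ) - 2 * s) / (2 * s))).Nonempty ∧
    ∀ β ∈ Set.Ioo (1 / (p - 1)) (((N : ℝ) - 2 * s) / (2 * s)),
      ∃ C : ℝ, 0 < C ∧
        (∀ x : EuclideanSpace ℝ (Fin N), 0 < C * (1 + ‖x‖) ^ (-(2 * s * β))) ∧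
        (∃ M : ℝ, ∀ x : EuclideanSpace ℝ (Fin N), C * (1 + ‖x‖) ^ (-(2 * s * β)) ≤ M) ∧
        ∀ q lam R₀ : ℝ, 0 ≤ q → lam ≤ 1 → 0 < R₀ →
          IsClassicalSupersolution s q lam (fun t : ℝ => t ^ p) R₀
            (fun x : EuclideanSpace ℝ (Fin N) => C * (1 + ‖x‖) ^ (-(2 * s * β))) := by
  have hγ : 0 < (N : ℝ) - 2 * s := sub_pos.2 hN
  have hN1 : 1 ≤ N := Nat.one_le_iff_ne_zero.2 (by rintro rfl; simp at hN; linarith)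
  rw [div_lt_iff₀ hγ] at hp
  have hp1 : 1 < p := by
    by_contra! h
    nlinarith
  have hne : (Set.Ioo (1 / (p - 1)) (((N : ℝ) - 2 * s) / (2 * s))).Nonempty := by
    -- Cross-multiplied, 2s < (N-2s)(p-1) is exactly N < p(N-2s).
    rw [Set.nonempty_Ioo, div_lt_div_iff₀ (by linarith) (by linarith)]
    linarith
  have key : ∀ β ∈ Set.Ioo (1 / (p - 1)) (((N : ℝ) - 2 * s) / (2 * s)),
      ∃ C : ℝ, 0 < C ∧
        (∀ x : EuclideanSpace ℝ (Fin N), 0 < C * (1 + ‖x‖) ^ (-(2 * s * β))) ∧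
        (∃ M : ℝ, ∀ x : EuclideanSpace ℝ (Fin N), C * (1 + ‖x‖) ^ (-(2 * s * β)) ≤ M) ∧
        ∀ q lam R₀ : ℝ, 0 ≤ q → lam ≤ 1 → 0 < R₀ →
          IsClassicalSupersolution s q lam (fun t : ℝ => t ^ p) R₀
            (fun x : EuclideanSpace ℝ (Fin N) => C * (1 + ‖x‖) ^ (-(2 * s * β))) := by
    rintro β ⟨hβ1, hβ2⟩
    have hβ0 : 0 < β := lt_trans (one_div_pos.2 (by linarith)) hβ1
    rw [div_lt_iff₀ (by linarith)] at hβ1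
    rw [lt_div_iff₀ (by linarith)] at hβ2
    have ha : 0 < 2 * s * β := by positivity
    obtain ⟨C, hC, h⟩ := exists_const_isClassicalSupersolution (a := 2 * s * β) hN1 hs0 hs1 hp1 ha
      (by linarith) (by nlinarith)
    exact ⟨C, hC, fun x => by positivity, ⟨C, fun x => mul_le_of_le_one_right hC.le
      ((le_abs_self _).trans (abs_one_add_norm_rpow_neg_le_one ha.le x))⟩,
      fun q lam R₀ _ => h q lam R₀⟩
  obtain ⟨β, hβ⟩ := hne
  obtain ⟨C, -, hpos, hbdd, h⟩ := key β hβ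
  exact ⟨⟨_, hpos, hbdd, h⟩, ⟨β, hβ⟩, key⟩
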